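/- Work over $\mathbb{C}$. Let $k\ge 1$ and $n\ge 2k$ be integers, and let $C_n=\nu_n(\mathbb{P}^1)\subset\mathbb{P}^n$ be the rational normal curve, $\nu_n([s:t])=[s^n:s^{n-1}t:\dots:t^n]$. Let $L\cong\mathbb{P}^{k-1}$ be a linear subspace of $\mathbb{P}^n$ with $L\cap C_n=\emptyset$, and let $\pi_L:\mathbb{P}^n\dashrightarrow\mathbb{P}^{n-k}$ be the linear projection with centre $L$, so that $f=\pi_L\circ\nu_n:\mathbb{P}^1\to\mathbb{P}^{n-k}$ is a morphism given by forms of degree $n$ without common zeros, parametrizing the curve $\pi_L(C_n)$. Suppose that $L$ is contained in some $(k+1)$-secant $\mathbb{P}^k$ to $C_n$, that is, in a $k$-dimensional linear subspace of $\mathbb{P}^n$ that contains $k+1$ distinct points of $C_n$. Then the restricted tangent bundle $T\mathbb{P}^{n-k}|_{\pi_L(C_n)}:=f^*T\mathbb{P}^{n-k}$ splits, as an algebraic vector bundle on $\mathbb{P}^1$, as $$f^*T\mathbb{P}^{n-k}\;\cong\;\mathcal{O}_{\mathbb{P}^1}(n+1)^{\oplus (n-k-1)}\oplus\mathcal{O}_{\mathbb{P}^1}(n+1+k).$$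 -/

import Mathlib

open scoped LinearAlgebra.Projectivization

noncomputable section

/-! ### Projective space over `ℂ` and its regular functions -/

/-- Complex projective space `ℙ^N`, the space of lines in `ℂ^(N+1)`. -/
abbrev PSpace (N : ℕ) : Type := ℙ ℂ (Fin (N + 1) → ℂ)

/-- Zariski-open subsets of `ℙ^N`: unions of basic open sets `{G ≠ 0}`, `G` homogeneous. -/
def IsZariskiOpen {N : ℕ} (U : Set (PSpace N)) : Prop :=
  ∀ (v : Fin (N + 1) → ℂ) (hv : v ≠ 0), Projectivization.mk ℂ v hv ∈ U →
    ∃ (d : ℕ) (G : MvPolynomial (Fin (N + 1)) ℂ), G.IsHomogeneous d ∧ MvPolynomial.eval v G ≠ 0 ∧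
      ∀ (w : Fin (N + 1) → ℂ) (hw : w ≠ 0), MvPolynomial.eval w G ≠ 0 →
        Projectivization.mk ℂ w hw ∈ U

/-- `f` is a regular function on the (open) set `U ⊆ ℙ^N`: near every point of `U` it is a quotient
`F / G` of two homogeneous polynomials of the same degree. Values outside `U` are irrelevant. -/
def IsRegularOn {N : ℕ} (f : PSpace N → ℂ) (U : Set (PSpace N)) : Prop :=
  ∀ (v : Fin (N + 1) → ℂ) (hv : v ≠ 0), Projectivization.mk ℂ v hv ∈ U →
    ∃ (d : ℕ) (F G : MvPolynomial (Fin (N + 1)) ℂ), F.IsHomogeneous d ∧ G.IsHomogeneous d ∧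
      MvPolynomial.eval v G ≠ 0 ∧
      ∀ (w : Fin (N + 1) → ℂ) (hw : w ≠ 0), Projectivization.mk ℂ w hw ∈ U →
        MvPolynomial.eval w G ≠ 0 →
        f (Projectivization.mk ℂ w hw) = MvPolynomial.eval w F / MvPolynomial.eval w G

/-! ### Algebraic vector bundles, given by transition matrices -/

/-- An algebraic vector bundle on `ℙ^N` with typical fibre `ℂ^κ`: a Zariski-open cover `U i` and
regular transition matrices on the overlaps satisfying the cocycle condition. A point of the fibre
over `p ∈ U i ∩ U j` with coordinates `x` in the chart `j` has coordinates `g i j p *ᵥ x` in the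
chart `i`. -/
structure AlgBundle (N : ℕ) (κ : Type) [Fintype κ] [DecidableEq κ] where
  ι : Type
  U : ι → Set (PSpace N)
  isOpen : ∀ i, IsZariskiOpen (U i)
  cover : ∀ p, ∃ i, p ∈ U i
  g : ι → ι → PSpace N → Matrix κ κ ℂ
  regular : ∀ i j a b, IsRegularOn (fun p => g i j p a b) (U i ∩ U j)
  self : ∀ i, ∀ p ∈ U i, g i i p = 1
  cocycle : ∀ i j k p, p ∈ U i → p ∈ U j → p ∈ U k → g i j p * g j k p = g i k p

namespace AlgBundle

variable {N : ℕ} {κ κ' : Type} [Fintype κ] [DecidableEq κ] [Fintype κ'] [DecidableEq κ']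

/-- A morphism of algebraic vector bundles over the identity of `ℙ^N`: in every pair of charts a
regular matrix, compatible with the transition matrices of the two bundles. -/
structure Hom (E : AlgBundle N κ) (E' : AlgBundle N κ') where
  mat : E'.ι → E.ι → PSpace N → Matrix κ' κ ℂ
  regular : ∀ a i x y, IsRegularOn (fun p => mat a i p x y) (E'.U a ∩ E.U i)
  compat : ∀ a b i j p, p ∈ E'.U a → p ∈ E'.U b → p ∈ E.U i → p ∈ E.U j →
    mat b j p * E.g j i p = E'.g b a p * mat a i p

/-- Two algebraic vector bundles are isomorphic if there are mutually inverse morphisms. -/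
def Isomorphic (E : AlgBundle N κ) (E' : AlgBundle N κ') : Prop :=
  ∃ (f : Hom E E') (h : Hom E' E), ∀ a i p, p ∈ E'.U a → p ∈ E.U i →
    f.mat a i p * h.mat i a p = 1 ∧ h.mat i a p * f.mat a i p = 1

end AlgBundle

/-! ### Standard affine charts of `ℙ^N` -/

/-- The standard affine open set `x_i ≠ 0`. -/
def stdOpen {N : ℕ} (i : Fin (N + 1)) : Set (PSpace N) := {p | p.rep i ≠ 0}

/-- The affine coordinates `x_l / x_i`, `l ≠ i`, on `x_i ≠ 0`, listed in increasing order of `l`. -/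
def stdCoord {N : ℕ} (i : Fin (N + 1)) (p : PSpace N) : Fin N → ℂ :=
  fun l => p.rep (i.succAbove l) / p.rep i

/-- The coordinate change from the chart `j` to the chart `i` of `ℙ^N`: the point with affine
coordinates `z` in the chart `j` is `[z with a 1 inserted in place j]`. -/
def coordChange {N : ℕ} (i j : Fin (N + 1)) (z : Fin N → ℂ) : Fin N → ℂ :=
  fun l => (j.insertNth 1 z : Fin (N + 1) → ℂ) (i.succAbove l) /
    (j.insertNth 1 z : Fin (N + 1) → ℂ) i

theorem rep_mk_div {N : ℕ} (v : Fin (N + 1) → ℂ) (hv : v ≠ 0) (l i : Fin (N + 1)) :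
    (Projectivization.mk ℂ v hv).rep l / (Projectivization.mk ℂ v hv).rep i = v l / v i := by
  obtain ⟨a, ha⟩ := Projectivization.exists_smul_eq_mk_rep ℂ v hv
  rw [← ha]
  have : (a : ℂ) ≠ 0 := a.ne_zero
  simp only [Units.smul_def, Pi.smul_apply, smul_eq_mul]
  rw [mul_div_mul_left _ _ this]

theorem mk_mem_stdOpen {N : ℕ} (v : Fin (N + 1) → ℂ) (hv : v ≠ 0) (i : Fin (N + 1)) :
    Projectivization.mk ℂ v hv ∈ stdOpen i ↔ v i ≠ 0 := by
  obtain ⟨a, ha⟩ := Projectivization.exists_smul_eq_mk_rep ℂ v hv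
  have : (a : ℂ) ≠ 0 := a.ne_zero
  change (Projectivization.mk ℂ v hv).rep i ≠ 0 ↔ _
  rw [← ha]
  simp [Units.smul_def]

theorem isZariskiOpen_stdOpen {N : ℕ} (i : Fin (N + 1)) : IsZariskiOpen (stdOpen i) := by
  intro v hv h
  rw [mk_mem_stdOpen] at h
  refine ⟨1, MvPolynomial.X i, MvPolynomial.isHomogeneous_X _ _, by simpa using h, ?_⟩
  intro w hw hG
  rw [mk_mem_stdOpen]
  simpa using hG

theorem stdOpen_cover {N : ℕ} (p : PSpace N) : ∃ i, p ∈ stdOpen i := by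
  by_contra! h
  exact p.rep_nonzero (funext fun i => by simpa [stdOpen] using h i)

/-! ### Direct sums of line bundles `𝒪(d)` -/

theorem regular_ratio_zpow {N : ℕ} (i j : Fin (N + 1)) (d : ℤ) :
    IsRegularOn (fun p => (p.rep j / p.rep i) ^ d) (stdOpen i ∩ stdOpen j) := by
  rintro v hv ⟨hi, hj⟩
  rw [mk_mem_stdOpen] at hi hj
  obtain ⟨m, rfl | rfl⟩ := d.eq_nat_or_neg
  · refine ⟨m, MvPolynomial.X j ^ m, MvPolynomial.X i ^ m,
      MvPolynomial.isHomogeneous_X_pow _ _, MvPolynomial.isHomogeneous_X_pow _ _,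
      by simp [hi], ?_⟩
    intro w hw _ _
    simp only [rep_mk_div]
    simp [div_pow]
  · refine ⟨m, MvPolynomial.X i ^ m, MvPolynomial.X j ^ m,
      MvPolynomial.isHomogeneous_X_pow _ _, MvPolynomial.isHomogeneous_X_pow _ _,
      by simp [hj], ?_⟩
    intro w hw _ _
    simp only [rep_mk_div]
    simp [div_pow]

theorem regular_zero {N : ℕ} (U : Set (PSpace N)) : IsRegularOn (fun _ => 0) U := by
  intro v hv _
  exact ⟨0, 0, 1, MvPolynomial.isHomogeneous_zero _ _ _, MvPolynomial.isHomogeneous_one _ _,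
    by simp, by simp⟩

/-- The bundle `⨁_a 𝒪(d a)` on `ℙ^N`. A local section of `𝒪(d)` is written `f_i x_i ^ d` on
`x_i ≠ 0`, so that `f_i = (x_j / x_i) ^ d f_j`. -/
def sumO (N : ℕ) {κ : Type} [Fintype κ] [DecidableEq κ] (d : κ → ℤ) : AlgBundle N κ where
  ι := Fin (N + 1)
  U := stdOpen
  isOpen := isZariskiOpen_stdOpen
  cover := stdOpen_cover
  g i j p := Matrix.diagonal fun a => (p.rep j / p.rep i) ^ d a
  regular i j a b := by
    by_cases h : a = b
    · subst h
      simpa using regular_ratio_zpow i j (d a)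
    · simpa [Matrix.diagonal_apply_ne _ h] using regular_zero _
  self i p hp := by
    have h : p.rep i ≠ 0 := hp
    simp [div_self h]
  cocycle i j k p hi hj hk := by
    have h1 : p.rep i ≠ 0 := hi
    have h2 : p.rep j ≠ 0 := hj
    rw [Matrix.diagonal_mul_diagonal]
    congr 1
    funext a
    rw [← mul_zpow]
    congr 1
    field_simp

/-! ### The tangent bundle of `ℙ^N` -/

/-- The Jacobian matrix of the coordinate change from chart `j` to chart `i`, at the point `p`. -/
def jacobian {N : ℕ} (i j : Fin (N + 1)) (p : PSpace N) : Matrix (Fin N) (Fin N) ℂ :=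
  LinearMap.toMatrix' (fderiv ℂ (coordChange i j) (stdCoord j p) :
    (Fin N → ℂ) →L[ℂ] (Fin N → ℂ)).toLinearMap

theorem insertNth_stdCoord {N : ℕ} (j l : Fin (N + 1)) (p : PSpace N) (hj : p ∈ stdOpen j) :
    (j.insertNth 1 (stdCoord j p) : Fin (N + 1) → ℂ) l = p.rep l / p.rep j := by
  have h : p.rep j ≠ 0 := hj
  refine Fin.succAboveCases j ?_ (fun l => ?_) l
  · simp [div_self h]
  · simp [stdCoord]

theorem hasFDerivAt_insertNth {N : ℕ} (j l : Fin (N + 1)) (z : Fin N → ℂ) :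
    ∃ D : (Fin N → ℂ) →L[ℂ] ℂ,
      HasFDerivAt (fun z : Fin N → ℂ => (j.insertNth 1 z : Fin (N + 1) → ℂ) l) D z ∧
      ∀ b, D (Pi.single b 1) = if j.succAbove b = l then 1 else 0 := by
  refine Fin.succAboveCases j ?_ (fun l => ?_) l
  · refine ⟨0, ?_, fun b => by simp [Fin.succAbove_ne]⟩
    simpa using hasFDerivAt_const (1 : ℂ) z
  · refine ⟨ContinuousLinearMap.proj l, ?_, fun b => ?_⟩
    · simpa using hasFDerivAt_apply (𝕜 := ℂ) l z
    · simp [Pi.single_apply, eq_comm]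

theorem jacobian_apply {N : ℕ} (i j : Fin (N + 1)) (p : PSpace N) (hi : p ∈ stdOpen i)
    (hj : p ∈ stdOpen j) (a b : Fin N) :
    jacobian i j p a b =
      (p.rep j / p.rep i) * ((if j.succAbove b = i.succAbove a then 1 else 0) -
        (if j.succAbove b = i then 1 else 0) * (p.rep (i.succAbove a) / p.rep i)) := by
  have h1 : p.rep i ≠ 0 := hi
  have h2 : p.rep j ≠ 0 := hj
  choose D hD hDb using fun l => hasFDerivAt_insertNth j l (stdCoord j p)
  have hne : (j.insertNth 1 (stdCoord j p) : Fin (N + 1) → ℂ) i ≠ 0 := by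
    rw [insertNth_stdCoord j i p hj]
    exact div_ne_zero h1 h2
  have key := hasFDerivAt_pi.2 fun l =>
    (hD (i.succAbove l)).mul ((hasDerivAt_inv hne).comp_hasFDerivAt (stdCoord j p) (hD i))
  have e : fderiv ℂ (coordChange i j) (stdCoord j p) = _ := HasFDerivAt.fderiv key
  rw [jacobian, LinearMap.toMatrix'_apply, e]
  simp only [ContinuousLinearMap.coe_coe, ContinuousLinearMap.pi_apply, add_apply,
    smul_apply, hDb, insertNth_stdCoord j _ p hj, Function.comp_apply,
    smul_eq_mul]
  split_ifs <;> field_simp <;> ring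

theorem regular_jacobian {N : ℕ} (i j : Fin (N + 1)) (a b : Fin N) :
    IsRegularOn (fun p => jacobian i j p a b) (stdOpen i ∩ stdOpen j) := by
  rintro v hv ⟨hi, -⟩
  rw [mk_mem_stdOpen] at hi
  refine ⟨2, MvPolynomial.X j *
      (MvPolynomial.C (if j.succAbove b = i.succAbove a then 1 else 0) * MvPolynomial.X i -
       MvPolynomial.C (if j.succAbove b = i then 1 else 0) * MvPolynomial.X (i.succAbove a)),
    MvPolynomial.X i ^ 2, ?_, MvPolynomial.isHomogeneous_X_pow _ _, by simp [hi], ?_⟩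
  · refine (MvPolynomial.isHomogeneous_X ℂ j).mul (n := 1) (MvPolynomial.IsHomogeneous.sub ?_ ?_)
    · exact (MvPolynomial.isHomogeneous_X ℂ i).C_mul _
    · exact (MvPolynomial.isHomogeneous_X ℂ _).C_mul _
  · rintro w hw ⟨hi', hj'⟩ hG
    dsimp only
    rw [jacobian_apply i j _ hi' hj', rep_mk_div, rep_mk_div]
    rw [mk_mem_stdOpen] at hi' hj'
    simp only [map_mul, map_sub, map_pow, MvPolynomial.eval_X, MvPolynomial.eval_C]
    field_simp

/-- The tangent bundle of `ℙ^N`: glued from the standard affine charts by the Jacobian matrices of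
the coordinate changes. -/
def tangentPSpace (N : ℕ) : AlgBundle N (Fin N) where
  ι := Fin (N + 1)
  U := stdOpen
  isOpen := isZariskiOpen_stdOpen
  cover := stdOpen_cover
  g := jacobian
  regular := regular_jacobian
  self i p hp := by
    have h : p.rep i ≠ 0 := hp
    ext a b
    rw [jacobian_apply i i p hp hp]
    simp [div_self h, Matrix.one_apply, eq_comm]
  cocycle i j k p hi hj hk := by
    have h1 : p.rep i ≠ 0 := hi
    have h2 : p.rep j ≠ 0 := hj
    ext a c
    rw [Matrix.mul_apply, jacobian_apply i k p hi hk]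
    have hs : ∀ b, jacobian i j p a b * jacobian j k p b c =
        (fun l : Fin (N + 1) => (p.rep j / p.rep i) * ((if l = i.succAbove a then 1 else 0) -
          (if l = i then 1 else 0) * (p.rep (i.succAbove a) / p.rep i)) *
          ((p.rep k / p.rep j) * ((if k.succAbove c = l then 1 else 0) -
          (if k.succAbove c = j then 1 else 0) * (p.rep l / p.rep j)))) (j.succAbove b) := by
      intro b
      rw [jacobian_apply i j p hi hj, jacobian_apply j k p hj hk]
    have hj0 : (fun l : Fin (N + 1) => (p.rep j / p.rep i) *
        ((if l = i.succAbove a then 1 else 0) -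
          (if l = i then 1 else 0) * (p.rep (i.succAbove a) / p.rep i)) *
          ((p.rep k / p.rep j) * ((if k.succAbove c = l then 1 else 0) -
          (if k.succAbove c = j then 1 else 0) * (p.rep l / p.rep j)))) j = 0 := by
      simp [div_self h2]
    rw [Finset.sum_congr rfl fun b _ => hs b]
    have := Fin.sum_univ_succAbove (fun l : Fin (N + 1) => (p.rep j / p.rep i) *
        ((if l = i.succAbove a then 1 else 0) -
          (if l = i then 1 else 0) * (p.rep (i.succAbove a) / p.rep i)) *
          ((p.rep k / p.rep j) * ((if k.succAbove c = l then 1 else 0) -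
          (if k.succAbove c = j then 1 else 0) * (p.rep l / p.rep j)))) j
    beta_reduce at this hj0
    rw [hj0, zero_add] at this
    rw [← this]
    have hsum : ∀ (x r : ℂ) (A : Fin (N + 1)) (h : Fin (N + 1) → ℂ),
        ∑ l, x * ((if l = A then 1 else 0) - (if l = i then 1 else 0) * r) * h l =
          x * (h A - r * h i) := by
      intro x r A h
      simp [mul_sub, sub_mul, Finset.sum_sub_distrib, mul_assoc]
    rw [hsum]
    split_ifs <;> field_simp <;> ring

/-! ### Morphisms of projective spaces and pull-backs -/

theorem eval_smul_of_isHomogeneous {σ : Type} {F : MvPolynomial σ ℂ} {d : ℕ}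
    (hF : F.IsHomogeneous d) (a : ℂ) (v : σ → ℂ) :
    MvPolynomial.eval (a • v) F = a ^ d * MvPolynomial.eval v F := by
  rw [MvPolynomial.eval_eq, MvPolynomial.eval_eq, Finset.mul_sum]
  refine Finset.sum_congr rfl fun m hm => ?_
  have h : m.degree = d := by
    rw [Finsupp.degree_eq_weight_one]
    exact hF (MvPolynomial.mem_support_iff.1 hm)
  simp only [Pi.smul_apply, smul_eq_mul, mul_pow, Finset.prod_mul_distrib, Finset.prod_pow_eq_pow_sum]
  rw [← h, Finsupp.degree_apply]
  ring

/-- A morphism `ℙ^N → ℙ^M`, given by `M + 1` forms of the same degree without common zeros. -/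
structure ProjMorphism (N M : ℕ) where
  deg : ℕ
  F : Fin (M + 1) → MvPolynomial (Fin (N + 1)) ℂ
  homogeneous : ∀ j, (F j).IsHomogeneous deg
  nonvanishing : ∀ v : Fin (N + 1) → ℂ, v ≠ 0 → (fun j => MvPolynomial.eval v (F j)) ≠ 0

namespace ProjMorphism

variable {N M M' : ℕ}

/-- The underlying map on points. -/
def toFun (f : ProjMorphism N M) (p : PSpace N) : PSpace M :=
  Projectivization.mk ℂ (fun j => MvPolynomial.eval p.rep (f.F j)) (f.nonvanishing _ p.rep_nonzero)

theorem toFun_mk (f : ProjMorphism N M) (v : Fin (N + 1) → ℂ) (hv : v ≠ 0) :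
    f.toFun (Projectivization.mk ℂ v hv) =
      Projectivization.mk ℂ (fun j => MvPolynomial.eval v (f.F j)) (f.nonvanishing v hv) := by
  obtain ⟨a, ha⟩ := Projectivization.exists_smul_eq_mk_rep ℂ v hv
  rw [toFun, Projectivization.mk_eq_mk_iff]
  refine ⟨a ^ f.deg, ?_⟩
  funext j
  simp only [← ha, Pi.smul_apply, Units.smul_def, smul_eq_mul, Units.val_pow_eq_pow_val]
  exact (eval_smul_of_isHomogeneous (f.homogeneous j) _ _).symm

theorem eval_bind (f : ProjMorphism N M) (G : MvPolynomial (Fin (M + 1)) ℂ)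
    (v : Fin (N + 1) → ℂ) : MvPolynomial.eval v (MvPolynomial.bind₁ f.F G) =
      MvPolynomial.eval (fun j => MvPolynomial.eval v (f.F j)) G := by
  exact MvPolynomial.eval₂Hom_bind₁ (RingHom.id ℂ) v f.F G

theorem homogeneous_bind (f : ProjMorphism N M) {G : MvPolynomial (Fin (M + 1)) ℂ} {d : ℕ}
    (hG : G.IsHomogeneous d) : (MvPolynomial.bind₁ f.F G).IsHomogeneous (f.deg * d) :=
  hG.aeval f.F f.homogeneous

theorem isZariskiOpen_preimage (f : ProjMorphism N M) {U : Set (PSpace M)} (hU : IsZariskiOpen U) :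
    IsZariskiOpen (f.toFun ⁻¹' U) := by
  intro v hv h
  rw [Set.mem_preimage, toFun_mk] at h
  obtain ⟨d, G, hG, hGv, H⟩ := hU _ _ h
  refine ⟨_, _, f.homogeneous_bind hG, by rwa [eval_bind], fun w hw hGw => ?_⟩
  rw [eval_bind] at hGw
  rw [Set.mem_preimage, toFun_mk]
  exact H _ _ hGw

theorem isRegularOn_comp (f : ProjMorphism N M) {U : Set (PSpace M)} {φ : PSpace M → ℂ}
    (hφ : IsRegularOn φ U) : IsRegularOn (fun p => φ (f.toFun p)) (f.toFun ⁻¹' U) := by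
  intro v hv h
  rw [Set.mem_preimage, toFun_mk] at h
  obtain ⟨d, F, G, hF, hG, hGv, H⟩ := hφ _ _ h
  refine ⟨_, _, _, f.homogeneous_bind hF, f.homogeneous_bind hG, by rwa [eval_bind], ?_⟩
  intro w hw hwU hGw
  rw [Set.mem_preimage, toFun_mk] at hwU
  rw [eval_bind] at hGw
  beta_reduce
  rw [toFun_mk, eval_bind, eval_bind]
  exact H _ _ hwU hGw

/-- The composition of `f : ℙ^N → ℙ^M` with the linear projection `ℙ^M ⇢ ℙ^M'` induced by a linear
map `A`, when the image of `f` is disjoint from the centre `ℙ(ker A)` of the projection. -/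
def project (f : ProjMorphism N M) (A : (Fin (M + 1) → ℂ) →ₗ[ℂ] (Fin (M' + 1) → ℂ))
    (h : ∀ p : PSpace N, ¬ (f.toFun p).submodule ≤ LinearMap.ker A) : ProjMorphism N M' where
  deg := f.deg
  F j := ∑ i, MvPolynomial.C (A (Pi.single i 1) j) * f.F i
  homogeneous j := MvPolynomial.IsHomogeneous.sum _ _ _ fun i _ => (f.homogeneous i).C_mul _
  nonvanishing v hv h0 := by
    apply h (Projectivization.mk ℂ v hv)
    rw [toFun_mk, Projectivization.submodule_mk, Submodule.span_singleton_le_iff_mem,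
      LinearMap.mem_ker, LinearMap.pi_apply_eq_sum_univ A]
    rw [← h0]
    funext j
    have hs : ∀ i : Fin (M + 1), (Pi.single i 1 : Fin (M + 1) → ℂ) = fun j => if i = j then 1 else 0 :=
      fun i => funext fun j => by simp [Pi.single_apply, eq_comm]
    simp [mul_comm, hs]

end ProjMorphism

/-- The pull-back of a vector bundle along a morphism: pull back the cover and the transition
matrices. -/
def AlgBundle.pullback {N M : ℕ} {κ : Type} [Fintype κ] [DecidableEq κ] (E : AlgBundle M κ)
    (f : ProjMorphism N M) : AlgBundle N κ where
  ι := E.ι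
  U i := f.toFun ⁻¹' E.U i
  isOpen i := f.isZariskiOpen_preimage (E.isOpen i)
  cover p := E.cover (f.toFun p)
  g i j p := E.g i j (f.toFun p)
  regular i j a b := f.isRegularOn_comp (E.regular i j a b)
  self i _ hp := E.self i _ hp
  cocycle i j k _ hi hj hk := E.cocycle i j k _ hi hj hk

/-! ### The rational normal curve -/

/-- The Veronese map `ν_n : ℙ^1 → ℙ^n`, `[s : t] ↦ [s^n : s^(n-1) t : ⋯ : t^n]`. -/
def veronese (n : ℕ) : ProjMorphism 1 n where
  deg := n
  F i := MvPolynomial.X 0 ^ (n - (i : ℕ)) * MvPolynomial.X 1 ^ (i : ℕ)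
  homogeneous i := by
    have h := (MvPolynomial.isHomogeneous_X_pow (R := ℂ) (0 : Fin 2) (n - (i : ℕ))).mul
      (MvPolynomial.isHomogeneous_X_pow (R := ℂ) (1 : Fin 2) (i : ℕ))
    rwa [Nat.sub_add_cancel (Nat.lt_succ_iff.1 i.2)] at h
  nonvanishing v hv h := by
    apply hv
    have h0 := congrFun h 0
    have h1 := congrFun h (Fin.last n)
    simp only [Fin.val_zero, Fin.val_last, map_pow, MvPolynomial.eval_X, Pi.zero_apply,
      Nat.sub_zero, Nat.sub_self, pow_zero, mul_one, one_mul] at h0 h1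
    funext i
    fin_cases i
    · exact eq_zero_of_pow_eq_zero h0
    · exact eq_zero_of_pow_eq_zero h1

/-- The rational normal curve `C_n ⊆ ℙ^n`. -/
def rationalNormalCurve (n : ℕ) : Set (PSpace n) := Set.range (veronese n).toFun

/-- The linear subspace `ℙ(M) ⊆ ℙ^n` is `m`-secant to `C_n`: it contains `m` distinct points of
`C_n`. -/
def IsSecant {n : ℕ} (m : ℕ) (M : Submodule ℂ (Fin (n + 1) → ℂ)) : Prop :=
  ∃ S : Finset (PSpace n), S.card = m ∧ (S : Set (PSpace n)) ⊆ rationalNormalCurve n ∧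
    ∀ q ∈ S, q.submodule ≤ M

end

/-! Write `n = m + (k + 1)`, so the target is `ℙ^(m+1)`, and let `P` be the form of degree `k + 1`
vanishing at the secant points. These points span `M`, so the hyperplanes containing `M` cut the
curve in the forms `P s^(m-j) t^j`. Since `L ≤ M`, these hyperplanes descend to the target. One more
functional `θ` has kernel `L` on `M`. Its restriction `F₀` to the curve has no zero in common with
`P`, because `L` misses the curve. In suitable coordinates, therefore, `f = (F₀, P s^m, …, P t^m)`.

Such an `f` has explicit syzygies: `t y_j - s y_(j+1)`, which are `m` of degree `1`, and `P y_θ - ∑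
B_j y_j` of degree `k + 1`, where `F₀ = ∑ B_j s^(m-j) t^j`. By the Euler sequence `f^*T` is the
quotient of `𝒪(n)^(m+2)` by the line spanned by `f`. The syzygy matrix maps this quotient to
`𝒪(n+1)^m ⊕ 𝒪(n+1+k)`. At every point its kernel is exactly that line, so the map is injective on
fibres, and equality of ranks makes it an isomorphism.

The geometric input is in `tangent_project_veronese`, the syzygies in
`tangent_pullback_isomorphic_of_forms`, and the Euler sequence in `tangent_pullback_isomorphic`. -/

noncomputable section

/-! ### The ring of regular functions -/

namespace IsRegularOn

variable {N : ℕ} {U V : Set (PSpace N)} {f g : PSpace N → ℂ}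

theorem mono (hf : IsRegularOn f U) (h : V ⊆ U) : IsRegularOn f V := by
  intro v hv hp
  obtain ⟨d, F, G, hF, hG, hGv, H⟩ := hf v hv (h hp)
  exact ⟨d, F, G, hF, hG, hGv, fun w hw hwV => H w hw (h hwV)⟩

theorem congr (hf : IsRegularOn f U) (h : ∀ p ∈ U, g p = f p) : IsRegularOn g U := by
  intro v hv hp
  obtain ⟨d, F, G, hF, hG, hGv, H⟩ := hf v hv hp
  exact ⟨d, F, G, hF, hG, hGv, fun w hw hwU hw' => (h _ hwU).trans (H w hw hwU hw')⟩

theorem const (c : ℂ) : IsRegularOn (fun _ => c) U := by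
  intro v hv _
  exact ⟨0, MvPolynomial.C c, 1, MvPolynomial.isHomogeneous_C _ _,
    MvPolynomial.isHomogeneous_one _ _, by simp, by simp⟩

theorem add (hf : IsRegularOn f U) (hg : IsRegularOn g U) : IsRegularOn (fun p => f p + g p) U := by
  intro v hv hp
  obtain ⟨d, F, G, hF, hG, hGv, H⟩ := hf v hv hp
  obtain ⟨d', F', G', hF', hG', hGv', H'⟩ := hg v hv hp
  refine ⟨d + d', F * G' + G * F', G * G', (hF.mul hG').add (hG.mul hF'), hG.mul hG',
    by simp [hGv, hGv'], fun w hw hwU hG0 => ?_⟩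
  simp only [map_mul, mul_ne_zero_iff] at hG0
  beta_reduce
  rw [H w hw hwU hG0.1, H' w hw hwU hG0.2, div_add_div _ _ hG0.1 hG0.2]
  simp

theorem mul (hf : IsRegularOn f U) (hg : IsRegularOn g U) : IsRegularOn (fun p => f p * g p) U := by
  intro v hv hp
  obtain ⟨d, F, G, hF, hG, hGv, H⟩ := hf v hv hp
  obtain ⟨d', F', G', hF', hG', hGv', H'⟩ := hg v hv hp
  refine ⟨d + d', F * F', G * G', hF.mul hF', hG.mul hG',
    by simp [hGv, hGv'], fun w hw hwU hG0 => ?_⟩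
  simp only [map_mul, mul_ne_zero_iff] at hG0
  beta_reduce
  rw [H w hw hwU hG0.1, H' w hw hwU hG0.2, div_mul_div_comm]
  simp

theorem inv (hf : IsRegularOn f U) (h0 : ∀ p ∈ U, f p ≠ 0) :
    IsRegularOn (fun p => (f p)⁻¹) U := by
  intro v hv hp
  obtain ⟨d, F, G, hF, hG, hGv, H⟩ := hf v hv hp
  have hFv : MvPolynomial.eval v F ≠ 0 := by
    intro h
    apply h0 _ hp
    rw [H v hv hp hGv, h, zero_div]
  -- The extra factor `G` keeps the local formula `f = F / G` valid wherever the new denominator is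
  -- nonzero.
  refine ⟨d + d, G * G, F * G, hG.mul hG, hF.mul hG,
    by simp [hGv, hFv], fun w hw hwU hG0 => ?_⟩
  simp only [map_mul, mul_ne_zero_iff] at hG0
  beta_reduce
  rw [H w hw hwU hG0.2, inv_div, map_mul, map_mul, mul_div_mul_right _ _ hG0.2]

theorem sum {α : Type} {φ : α → PSpace N → ℂ} (s : Finset α) (h : ∀ i, IsRegularOn (φ i) U) :
    IsRegularOn (fun p => ∑ i ∈ s, φ i p) U := by
  classical
  induction s using Finset.induction_on with
  | empty => simpa using const 0
  | insert i s hi ih => simpa [Finset.sum_insert hi] using (h i).add ih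

theorem prod {α : Type} {φ : α → PSpace N → ℂ} (s : Finset α) (h : ∀ i, IsRegularOn (φ i) U) :
    IsRegularOn (fun p => ∏ i ∈ s, φ i p) U := by
  classical
  induction s using Finset.induction_on with
  | empty => simpa using const 1
  | insert i s hi ih => simpa [Finset.prod_insert hi] using (h i).mul ih

variable {κ : Type} [Fintype κ] [DecidableEq κ] {A : PSpace N → Matrix κ κ ℂ}

theorem det (h : ∀ a b, IsRegularOn (fun p => A p a b) U) : IsRegularOn (fun p => (A p).det) U := by
  simp only [Matrix.det_apply']
  exact sum _ fun σ => (const _).mul (prod _ fun i => h _ _)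

/-- Cramer's rule: adjugate entries are themselves determinants, and the determinant is an
invertible regular function. -/
theorem matrix_inv (h : ∀ a b, IsRegularOn (fun p => A p a b) U)
    (h0 : ∀ p ∈ U, (A p).det ≠ 0) (a b : κ) : IsRegularOn (fun p => (A p)⁻¹ a b) U := by
  have hadj : IsRegularOn (fun p => (A p).adjugate a b) U := by
    simp only [Matrix.adjugate_apply]
    refine det fun c d => ?_
    by_cases hc : c = b
    · subst hc
      simpa using const _
    · simpa [Matrix.updateRow_ne hc] using h c d
  refine (((det h).inv h0).mul hadj).congr fun p _ => ?_
  simp [Matrix.inv_def]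

end IsRegularOn

/-! ### Isomorphisms of bundles -/

namespace AlgBundle

variable {N : ℕ} {κ κ' : Type} [Fintype κ] [DecidableEq κ] [Fintype κ'] [DecidableEq κ']

/-- A morphism between bundles of the same rank that is injective on every fibre is an
isomorphism. -/
theorem Hom.isomorphic {E : AlgBundle N κ} {E' : AlgBundle N κ'} (f : Hom E E') (e : κ ≃ κ')
    (hf : ∀ a i p, p ∈ E'.U a → p ∈ E.U i → ∀ x, (f.mat a i p).mulVec x = 0 → x = 0) :
    Isomorphic E E' := by
  -- Reindexing rows by `e` makes the matrix square, so that determinants and Cramer's rule apply.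
  have hdet : ∀ a i p, p ∈ E'.U a → p ∈ E.U i →
      ((f.mat a i p).submatrix e id).det ≠ 0 := by
    intro a i p ha hi h0
    obtain ⟨x, hx, hx0⟩ := Matrix.exists_mulVec_eq_zero_iff.2 h0
    refine hx (hf a i p ha hi x (funext fun r => ?_))
    simpa [Matrix.mulVec, dotProduct] using congrFun hx0 (e.symm r)
  let B : E.ι → E'.ι → PSpace N → Matrix κ κ' ℂ :=
    fun i a p => (((f.mat a i p).submatrix e id)⁻¹).submatrix id e.symm
  have hBf : ∀ a i p, p ∈ E'.U a → p ∈ E.U i → B i a p * f.mat a i p = 1 := by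
    intro a i p ha hi
    have h := Matrix.nonsing_inv_mul _ (isUnit_iff_ne_zero.2 (hdet a i p ha hi))
    rw [← h]
    have : f.mat a i p = ((f.mat a i p).submatrix e id).submatrix e.symm id := by
      ext; simp
    conv_lhs => rw [this]
    exact Matrix.submatrix_mul_equiv _ _ _ e.symm _
  have hfB : ∀ a i p, p ∈ E'.U a → p ∈ E.U i → f.mat a i p * B i a p = 1 := by
    intro a i p ha hi
    have h := Matrix.mul_nonsing_inv _ (isUnit_iff_ne_zero.2 (hdet a i p ha hi))
    have : f.mat a i p = ((f.mat a i p).submatrix e id).submatrix e.symm id := by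
      ext; simp
    conv_lhs => rw [this]
    refine (Matrix.submatrix_mul_equiv _ _ _ (Equiv.refl κ) _).trans ?_
    rw [h]
    simp
  refine ⟨f, ⟨B, fun i a x y => ?_, fun i j a b p hi hj ha hb => ?_⟩,
    fun a i p ha hi => ⟨hfB a i p ha hi, hBf a i p ha hi⟩⟩
  · refine IsRegularOn.matrix_inv (A := fun p => (f.mat a i p).submatrix e id) ?_ ?_ _ _
    · exact fun c d => (f.regular a i (e c) d).mono fun p hp => ⟨hp.2, hp.1⟩
    · exact fun p hp => hdet a i p hp.2 hp.1
  · calc B j b p * E'.g b a p = B j b p * E'.g b a p * (f.mat a i p * B i a p) := by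
          rw [hfB a i p ha hi, Matrix.mul_one]
      _ = B j b p * (f.mat b j p * E.g j i p) * B i a p := by
          rw [f.compat a b i j p ha hb hi hj]
          simp only [Matrix.mul_assoc]
      _ = E.g j i p * B i a p := by
          rw [← Matrix.mul_assoc, hBf b j p hb hj, Matrix.one_mul]

end AlgBundle

/-! ### Pull-backs of the tangent bundle through the Euler sequence -/

section Euler

variable {N M : ℕ} {κ : Type}

theorem rep_toFun_div (f : ProjMorphism N M) (p : PSpace N) (l i : Fin (M + 1)) :
    (f.toFun p).rep l / (f.toFun p).rep i =
      MvPolynomial.eval p.rep (f.F l) / MvPolynomial.eval p.rep (f.F i) :=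
  rep_mk_div _ _ _ _

theorem toFun_mem_stdOpen (f : ProjMorphism N M) (p : PSpace N) (i : Fin (M + 1)) :
    f.toFun p ∈ stdOpen i ↔ MvPolynomial.eval p.rep (f.F i) ≠ 0 :=
  mk_mem_stdOpen _ _ _

/-- The chart representation of the morphism `f^*Tℙ^M → ⨁ 𝒪(deg f + e r)` induced by a matrix of
forms `𝒪(deg f)^(M+1) → ⨁ 𝒪(deg f + e r)` that kills the tautological section. -/
def eulerMatrix (f : ProjMorphism N M) (e : κ → ℕ)
    (A : κ → Fin (M + 1) → MvPolynomial (Fin (N + 1)) ℂ) (a : Fin (N + 1)) (j : Fin (M + 1))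
    (p : PSpace N) : Matrix κ (Fin M) ℂ :=
  -- In chart `j` the `b`-th coordinate vector is the image of `y_j ∂/∂y_l` with `l = j.succAbove
  -- b`, whence the factor `f.F j`. The power of `p.rep a` trivialises `𝒪(deg f + e r)`.
  Matrix.of fun r b => MvPolynomial.eval p.rep (A r (j.succAbove b)) *
    MvPolynomial.eval p.rep (f.F j) / p.rep a ^ (f.deg + e r)

theorem regular_eulerMatrix (f : ProjMorphism N M) {e : κ → ℕ}
    {A : κ → Fin (M + 1) → MvPolynomial (Fin (N + 1)) ℂ} (hA : ∀ r j, (A r j).IsHomogeneous (e r))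
    (a : Fin (N + 1)) (j : Fin (M + 1)) (r : κ) (b : Fin M) :
    IsRegularOn (fun p => eulerMatrix f e A a j p r b) (stdOpen a) := by
  intro v hv ha
  rw [mk_mem_stdOpen] at ha
  have hAh := (hA r (j.succAbove b)).mul (f.homogeneous j)
  refine ⟨f.deg + e r, A r (j.succAbove b) * f.F j, MvPolynomial.X a ^ (f.deg + e r),
    by rwa [add_comm f.deg], MvPolynomial.isHomogeneous_X_pow _ _, by simp [ha], ?_⟩
  intro w hw _ hw0
  obtain ⟨c, hc⟩ := Projectivization.exists_smul_eq_mk_rep ℂ w hw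
  have hc0 : (c : ℂ) ≠ 0 := c.ne_zero
  beta_reduce
  rw [eulerMatrix, Matrix.of_apply, ← hc, ← map_mul, Units.smul_def,
    eval_smul_of_isHomogeneous hAh, Pi.smul_apply, smul_eq_mul, mul_pow, add_comm (e r),
    mul_div_mul_left _ _ (pow_ne_zero _ hc0)]
  simp

/-- Lifts of one tangent vector from two charts differ by a multiple of the Euler field, which `A`
kills by `hAF`. -/
theorem eulerMatrix_mul_jacobian [Fintype κ] [DecidableEq κ] (f : ProjMorphism N M)
    (e : κ → ℕ)
    {A : κ → Fin (M + 1) → MvPolynomial (Fin (N + 1)) ℂ}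
    (hAF : ∀ v r, ∑ j, MvPolynomial.eval v (A r j) * MvPolynomial.eval v (f.F j) = 0)
    (a b : Fin (N + 1)) (i j : Fin (M + 1)) (p : PSpace N) (ha : p ∈ stdOpen a)
    (hi : f.toFun p ∈ stdOpen i) (hj : f.toFun p ∈ stdOpen j) :
    eulerMatrix f e A b j p * jacobian j i (f.toFun p) =
      Matrix.diagonal (fun r => (p.rep a / p.rep b) ^ ((f.deg + e r : ℕ) : ℤ)) *
        eulerMatrix f e A a i p := by
  have ha : p.rep a ≠ 0 := ha
  have hj' := (toFun_mem_stdOpen f p j).1 hj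
  ext r c
  rw [Matrix.diagonal_mul, Matrix.mul_apply]
  simp only [jacobian_apply j i _ hj hi, rep_toFun_div, eulerMatrix, Matrix.of_apply, zpow_natCast]
  have hqy := hAF p.rep r
  set y : Fin (M + 1) → ℂ := fun l => MvPolynomial.eval p.rep (f.F l) with hy
  set q : Fin (M + 1) → ℂ := fun l => MvPolynomial.eval p.rep (A r l) with hq
  change ∑ l, q l * y l = 0 at hqy
  have hs := Fin.sum_univ_succAbove (fun l => q l * y j / p.rep b ^ (f.deg + e r) *
    (y i / y j * ((if i.succAbove c = l then 1 else 0) -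
      (if i.succAbove c = j then 1 else 0) * (y l / y j)))) j
  -- The term `l = j` vanishes, so the sum over chart coordinates extends to all homogeneous
  -- coordinates.
  have h0 : (if i.succAbove c = j then (1 : ℂ) else 0) -
      (if i.succAbove c = j then 1 else 0) * (y j / y j) = 0 := by
    rw [div_self hj']; ring
  rw [h0, mul_zero, mul_zero, zero_add] at hs
  refine hs.symm.trans ?_
  have hsum : ∀ l, q l * y j / p.rep b ^ (f.deg + e r) *
    (y i / y j * ((if i.succAbove c = l then 1 else 0) -
      (if i.succAbove c = j then 1 else 0) * (y l / y j))) =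
      (if i.succAbove c = l then q l * y i / p.rep b ^ (f.deg + e r) else 0) -
      (if i.succAbove c = j then 1 else 0) * y i / y j / p.rep b ^ (f.deg + e r) *
        (q l * y l) := by
    intro l
    have : y j ≠ 0 := hj'
    split_ifs <;> field_simp <;> ring
  rw [Finset.sum_congr rfl fun l _ => hsum l, Finset.sum_sub_distrib, ← Finset.mul_sum, hqy]
  simp only [Finset.sum_ite_eq, Finset.mem_univ, if_true, mul_zero, sub_zero]
  change q (i.succAbove c) * y i / _ = _ * (q (i.succAbove c) * y i / _)
  rw [div_pow]
  field_simp

/-- Lift a tangent vector in chart `i` to have `i`-th coordinate `0`. If `A` kills the lift, it lies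
on the tautological line, where the `i`-th coordinate is nonzero off the origin. -/
theorem eulerMatrix_injective (f : ProjMorphism N M) (e : κ → ℕ)
    {A : κ → Fin (M + 1) → MvPolynomial (Fin (N + 1)) ℂ}
    (hker : ∀ v ≠ 0, ∀ x : Fin (M + 1) → ℂ, (∀ r, ∑ j, MvPolynomial.eval v (A r j) * x j = 0) →
      ∃ c : ℂ, ∀ j, x j = c * MvPolynomial.eval v (f.F j))
    (a : Fin (N + 1)) (i : Fin (M + 1)) (p : PSpace N) (ha : p ∈ stdOpen a)
    (hi : f.toFun p ∈ stdOpen i) (x : Fin M → ℂ) (hx : (eulerMatrix f e A a i p).mulVec x = 0) :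
    x = 0 := by
  have ha : p.rep a ≠ 0 := ha
  rw [toFun_mem_stdOpen] at hi
  obtain ⟨c, hc⟩ := hker p.rep p.rep_nonzero (i.insertNth (α := fun _ => ℂ) 0 x) fun r => by
    rw [Fin.sum_univ_succAbove _ i]
    have h : ∑ b, MvPolynomial.eval p.rep (A r (i.succAbove b)) *
      MvPolynomial.eval p.rep (f.F i) / p.rep a ^ (f.deg + e r) * x b = 0 := congrFun hx r
    have h' : (MvPolynomial.eval p.rep (f.F i) / p.rep a ^ (f.deg + e r)) *
        ∑ b, MvPolynomial.eval p.rep (A r (i.succAbove b)) * x b = 0 := by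
      rw [← h, Finset.mul_sum]
      exact Finset.sum_congr rfl fun b _ => by ring
    simpa using (mul_eq_zero.1 h').resolve_left (div_ne_zero hi (pow_ne_zero _ ha))
  have hc0 : c = 0 := by
    have := hc i
    rw [Fin.insertNth_apply_same] at this
    exact (mul_eq_zero.1 this.symm).resolve_right hi
  funext b
  have := hc (i.succAbove b)
  rwa [Fin.insertNth_apply_succAbove, hc0, zero_mul] at this

/-- If the forms `A` induce, at every point, a map whose kernel is the tautological line, then
`f^*Tℙ^M` splits accordingly. -/
theorem tangent_pullback_isomorphic [Fintype κ] [DecidableEq κ] (f : ProjMorphism N M)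
    (e : κ → ℕ)
    (hκ : Fintype.card κ = M)
    (A : κ → Fin (M + 1) → MvPolynomial (Fin (N + 1)) ℂ) (hA : ∀ r j, (A r j).IsHomogeneous (e r))
    (hAF : ∀ v r, ∑ j, MvPolynomial.eval v (A r j) * MvPolynomial.eval v (f.F j) = 0)
    (hker : ∀ v ≠ 0, ∀ x : Fin (M + 1) → ℂ, (∀ r, ∑ j, MvPolynomial.eval v (A r j) * x j = 0) →
      ∃ c : ℂ, ∀ j, x j = c * MvPolynomial.eval v (f.F j)) :
    AlgBundle.Isomorphic ((tangentPSpace M).pullback f)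
      (sumO N fun r => ((f.deg + e r : ℕ) : ℤ)) :=
  AlgBundle.Hom.isomorphic
    (E := (tangentPSpace M).pullback f) (E' := sumO N fun r => ((f.deg + e r : ℕ) : ℤ))
    { mat := eulerMatrix f e A
      regular := fun a i r b => (regular_eulerMatrix f hA a i r b).mono Set.inter_subset_left
      compat := fun a b i j p ha _ hi hj => eulerMatrix_mul_jacobian f e hAF a b i j p ha hi hj }
    (Fintype.equivOfCardEq (by simp [hκ])) (eulerMatrix_injective f e hker)

end Euler

end
noncomputable section

/-! ### Binary forms -/

section BinaryForms

open MvPolynomial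

theorem degree_fin_two {n : ℕ} {H : MvPolynomial (Fin 2) ℂ} (hH : H.IsHomogeneous n)
    {d : Fin 2 →₀ ℕ} (hd : d ∈ H.support) : d 0 + d 1 = n := by
  have h : d.degree = n := by
    rw [Finsupp.degree_eq_weight_one]
    exact hH (mem_support_iff.1 hd)
  rwa [Finsupp.degree_eq_sum, Fin.sum_univ_two] at h

/-- Every form of degree `m + e` lies in the ideal generated by the monomials of degree `m`. -/
theorem exists_sum_mul_monomials {m e : ℕ} {H : MvPolynomial (Fin 2) ℂ}
    (hH : H.IsHomogeneous (m + e)) :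
    ∃ B : Fin (m + 1) → MvPolynomial (Fin 2) ℂ, (∀ j, (B j).IsHomogeneous e) ∧
      ∀ v, eval v H = ∑ j, eval v (B j) * (v 0 ^ (m - (j : ℕ)) * v 1 ^ (j : ℕ)) := by
  have key : ∀ d ∈ H.support, ∃ B : Fin (m + 1) → MvPolynomial (Fin 2) ℂ,
      (∀ j, (B j).IsHomogeneous e) ∧ ∀ v : Fin 2 → ℂ,
        v 0 ^ d 0 * v 1 ^ d 1 = ∑ j, eval v (B j) * (v 0 ^ (m - (j : ℕ)) * v 1 ^ (j : ℕ)) := by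
    intro d hd
    have hdeg := degree_fin_two hH hd
    -- A divisor of degree `m` of the monomial is found with `i = min (d 1) m`.
    obtain ⟨i, h0, h1⟩ : ∃ i : Fin (m + 1), (i : ℕ) ≤ d 1 ∧ m - (i : ℕ) ≤ d 0 := by
      by_cases h : d 1 ≤ m
      · exact ⟨⟨d 1, by omega⟩, le_rfl, by simp only; omega⟩
      · exact ⟨⟨m, by omega⟩, by simp only; omega, by simp⟩
    refine ⟨Pi.single i (X 0 ^ (d 0 - (m - (i : ℕ))) * X 1 ^ (d 1 - (i : ℕ))), fun j => ?_,
      fun v => ?_⟩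
    · by_cases hj : j = i
      · subst hj
        have h := (isHomogeneous_X_pow (R := ℂ) (0 : Fin 2) (d 0 - (m - (j : ℕ)))).mul
          (isHomogeneous_X_pow (R := ℂ) (1 : Fin 2) (d 1 - (j : ℕ)))
        rw [show d 0 - (m - (j : ℕ)) + (d 1 - (j : ℕ)) = e by omega] at h
        simpa using h
      · simpa [Pi.single_eq_of_ne hj] using isHomogeneous_zero _ _ _
    · rw [Finset.sum_eq_single i]
      · simp only [Pi.single_eq_same, map_mul, map_pow, eval_X]
        rw [mul_mul_mul_comm, ← pow_add, ← pow_add, Nat.sub_add_cancel h1, Nat.sub_add_cancel h0]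
      · intro j _ hj
        simp [Pi.single_eq_of_ne hj]
      · simp
  choose! B hB hBv using key
  refine ⟨fun j => ∑ d ∈ H.support, C (coeff d H) * B d j, fun j => ?_, fun v => ?_⟩
  · exact IsHomogeneous.sum _ _ _ fun d hd => (hB d hd j).C_mul _
  · rw [eval_eq']
    simp only [Fin.prod_univ_two, map_sum, map_mul, eval_C, Finset.sum_mul]
    rw [Finset.sum_comm]
    refine Finset.sum_congr rfl fun d hd => ?_
    rw [hBv d hd v, Finset.mul_sum]
    exact Finset.sum_congr rfl fun j _ => by ring

/-- Over an infinite field the pointwise identity is one of polynomials, so `P` cancels. Setting the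
first variable to `1` then separates the monomials. -/
theorem coeff_eq_zero_of_mul_eval_eq_zero {m : ℕ} {P : MvPolynomial (Fin 2) ℂ} (hP : P ≠ 0)
    {c : Fin (m + 1) → ℂ}
    (h : ∀ v, eval v P * ∑ j, c j * (v 0 ^ (m - (j : ℕ)) * v 1 ^ (j : ℕ)) = 0) : c = 0 := by
  have hQ : (∑ j, C (c j) * (X 0 ^ (m - (j : ℕ)) * X 1 ^ (j : ℕ)) : MvPolynomial (Fin 2) ℂ) = 0 := by
    refine (mul_eq_zero.1 (funext fun v => ?_ : P * _ = 0)).resolve_left hP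
    simpa using h v
  have hp : (∑ j, Polynomial.C (c j) * Polynomial.X ^ (j : ℕ) : Polynomial ℂ) = 0 := by
    simpa using congrArg (aeval (![1, Polynomial.X] : Fin 2 → Polynomial ℂ)) hQ
  funext i
  have := congrArg (fun p => Polynomial.coeff p (i : ℕ)) hp
  simpa [Polynomial.finsetSum_coeff, Polynomial.coeff_X_pow, Fin.val_inj] using this

/-- The relations make `y` a geometric progression of ratio `v 1 / v 0`; if `v 0 = 0`, only the last
entry survives. This computes the kernel of the degree-one syzygies. -/
theorem exists_eq_mul_monomial {m : ℕ} {v : Fin 2 → ℂ} (hv : v ≠ 0) (y : Fin (m + 1) → ℂ)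
    (h : ∀ r : Fin m, v 1 * y r.castSucc = v 0 * y r.succ) :
    ∃ c, ∀ j : Fin (m + 1), y j = c * (v 0 ^ (m - (j : ℕ)) * v 1 ^ (j : ℕ)) := by
  by_cases h0 : v 0 = 0
  · have h1 : v 1 ≠ 0 := fun h1 => hv (by funext i; fin_cases i <;> assumption)
    refine ⟨y (Fin.last m) / v 1 ^ m, fun j => ?_⟩
    refine Fin.lastCases ?_ (fun r => ?_) j
    · simp [h1]
    · have hr := h r
      rw [h0, zero_mul] at hr
      rw [(mul_eq_zero.1 hr).resolve_left h1, h0, zero_pow (by simp; omega)]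
      simp
  · refine ⟨y 0 / v 0 ^ m, fun j => ?_⟩
    induction j using Fin.induction with
    | zero => simp [h0]
    | succ r ih =>
      have hr := h r
      rw [ih] at hr
      apply mul_left_cancel₀ h0
      rw [← hr, Fin.val_castSucc, Fin.val_succ,
        show m - (r : ℕ) = m - ((r : ℕ) + 1) + 1 by omega]
      ring

/-- The linear form vanishing at `[a 0 : a 1]`. -/
def linForm (a : Fin 2 → ℂ) : MvPolynomial (Fin 2) ℂ := C (a 1) * X 0 - C (a 0) * X 1

theorem eval_linForm (a v : Fin 2 → ℂ) : eval v (linForm a) = a 1 * v 0 - a 0 * v 1 := by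
  simp [linForm]

theorem isHomogeneous_linForm (a : Fin 2 → ℂ) : (linForm a).IsHomogeneous 1 :=
  ((isHomogeneous_X ℂ 0).C_mul _).sub ((isHomogeneous_X ℂ 1).C_mul _)

theorem linForm_ne_zero {a : Fin 2 → ℂ} (ha : a ≠ 0) : linForm a ≠ 0 := by
  intro h
  apply ha
  have h0 := eval_linForm a ![1, 0]
  have h1 := eval_linForm a ![0, 1]
  rw [h] at h0 h1
  funext i
  fin_cases i
  · simpa using h1.symm
  · simpa using h0.symm

theorem isHomogeneous_prod_linForm {ι : Type} (s : Finset ι) (a : ι → Fin 2 → ℂ) :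
    (∏ i ∈ s, linForm (a i)).IsHomogeneous s.card := by
  simpa using IsHomogeneous.prod s (fun i => linForm (a i)) (fun _ => 1)
    fun i _ => isHomogeneous_linForm (a i)

theorem mk_eq_mk_of_eval_linForm {a v : Fin 2 → ℂ} (ha : a ≠ 0) (hv : v ≠ 0)
    (h : eval v (linForm a) = 0) : Projectivization.mk ℂ v hv = Projectivization.mk ℂ a ha := by
  rw [eval_linForm, sub_eq_zero] at h
  rw [Projectivization.mk_eq_mk_iff']
  by_cases h0 : a 0 = 0
  · have h1 : a 1 ≠ 0 := fun h1 => ha (by funext i; fin_cases i <;> assumption)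
    refine ⟨v 1 / a 1, ?_⟩
    funext i
    fin_cases i
    · rw [h0, zero_mul] at h
      simpa [h0] using ((mul_eq_zero.1 h).resolve_left h1).symm
    · simp [h1]
  · refine ⟨v 0 / a 0, ?_⟩
    funext i
    fin_cases i
    · simp [h0]
    · simp only [Pi.smul_apply, smul_eq_mul, Fin.mk_one]
      field_simp
      linear_combination h

end BinaryForms

/-! ### Curves with a point of high multiplicity -/

/-- If `m + 1` hyperplanes cut the curve in the forms `P s^(m-j) t^j`, and a further hyperplane
avoids the zeros of `P`, then the pulled back tangent bundle splits. -/
theorem tangent_pullback_isomorphic_of_forms {m k : ℕ} (f : ProjMorphism 1 (m + 1))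
    (hdeg : f.deg = m + (k + 1)) {P : MvPolynomial (Fin 2) ℂ} (hP : P.IsHomogeneous (k + 1))
    (hP0 : P ≠ 0) {t : Fin 2 → ℂ} (ht : t ≠ 0) (hPt : MvPolynomial.eval t P = 0)
    (ψ : Fin (m + 1) → Fin (m + 2) → ℂ) (θ : Fin (m + 2) → ℂ)
    (hψ : ∀ v j, ∑ l, ψ j l * MvPolynomial.eval v (f.F l) =
      MvPolynomial.eval v P * (v 0 ^ (m - (j : ℕ)) * v 1 ^ (j : ℕ)))
    (hθ : ∀ v ≠ 0, MvPolynomial.eval v P = 0 → ∑ l, θ l * MvPolynomial.eval v (f.F l) ≠ 0) :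
    AlgBundle.Isomorphic ((tangentPSpace (m + 1)).pullback f)
      (sumO 1 fun r => ((f.deg + (Sum.elim (fun _ : Fin m => 1) (fun _ : Unit => k + 1)) r : ℕ) :
        ℤ)) := by
  have hF0 : (∑ l, MvPolynomial.C (θ l) * f.F l).IsHomogeneous (m + (k + 1)) :=
    MvPolynomial.IsHomogeneous.sum _ _ _ fun l _ => by
      have := (f.homogeneous l).C_mul (θ l)
      rwa [hdeg] at this
  -- The `B j` are the coefficients of the syzygy of degree `k + 1`.
  obtain ⟨B, hB, hBv⟩ := exists_sum_mul_monomials hF0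
  simp only [map_sum, map_mul, MvPolynomial.eval_C] at hBv
  -- `θ` and the `ψ j` are linear coordinates: evaluating a linear relation among them along the
  -- curve at the zero `t` of `P` kills the coefficient of `θ`, and the forms `P s^(m-j) t^j` are
  -- independent.
  have hinj : ∀ x : Fin (m + 2) → ℂ, ∑ l, θ l * x l = 0 → (∀ j, ∑ l, ψ j l * x l = 0) → x = 0 := by
    intro x h0 h1
    by_contra hx
    let Ψ : Matrix (Fin (m + 2)) (Fin (m + 2)) ℂ :=
      Matrix.of (Fin.cons θ ψ : Fin (m + 2) → Fin (m + 2) → ℂ)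
    have hΨ : Ψ.mulVec x = 0 := by
      funext i
      refine Fin.cases ?_ (fun j => ?_) i
      · exact h0
      · exact h1 j
    obtain ⟨c, hc, hcΨ⟩ := Matrix.exists_vecMul_eq_zero_iff.2
      (Matrix.exists_mulVec_eq_zero_iff.1 ⟨x, hx, hΨ⟩)
    have hcv : ∀ v, c 0 * ∑ l, θ l * MvPolynomial.eval v (f.F l) +
        MvPolynomial.eval v P *
          ∑ j : Fin (m + 1), c j.succ * (v 0 ^ (m - (j : ℕ)) * v 1 ^ (j : ℕ)) = 0 := by
      intro v
      have h := congrArg (fun z => z ⬝ᵥ fun l => MvPolynomial.eval v (f.F l)) hcΨ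
      simp only [zero_dotProduct] at h
      rw [← Matrix.dotProduct_mulVec, dotProduct, Fin.sum_univ_succ] at h
      refine Eq.trans (congrArg₂ (· + ·) rfl ?_) h
      rw [Finset.mul_sum]
      refine Finset.sum_congr rfl fun j _ => ?_
      rw [mul_left_comm, ← hψ]
      rfl
    have hc0 : c 0 = 0 := by
      have h := hcv t
      rw [hPt, zero_mul, add_zero] at h
      exact (mul_eq_zero.1 h).resolve_right (hθ t ht hPt)
    simp only [hc0, zero_mul, zero_add] at hcv
    have hcs := coeff_eq_zero_of_mul_eval_eq_zero hP0 hcv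
    apply hc
    funext i
    refine Fin.cases ?_ (fun j => ?_) i
    · exact hc0
    · exact congrFun hcs j
  let A : Fin m ⊕ Unit → Fin (m + 2) → MvPolynomial (Fin 2) ℂ := Sum.elim
    (fun r l => MvPolynomial.C (ψ r.castSucc l) * MvPolynomial.X 1 -
      MvPolynomial.C (ψ r.succ l) * MvPolynomial.X 0)
    (fun _ l => MvPolynomial.C (θ l) * P - ∑ j, MvPolynomial.C (ψ j l) * B j)
  have hAl : ∀ (v : Fin 2 → ℂ) (r : Fin m) (x : Fin (m + 2) → ℂ),
      ∑ l, MvPolynomial.eval v (A (Sum.inl r) l) * x l =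
        v 1 * ∑ l, ψ r.castSucc l * x l - v 0 * ∑ l, ψ r.succ l * x l := by
    intro v r x
    rw [Finset.mul_sum, Finset.mul_sum, ← Finset.sum_sub_distrib]
    refine Finset.sum_congr rfl fun l _ => ?_
    simp only [A, Sum.elim_inl, map_sub, map_mul, MvPolynomial.eval_C, MvPolynomial.eval_X]
    ring
  have hAr : ∀ (v : Fin 2 → ℂ) (u : Unit) (x : Fin (m + 2) → ℂ),
      ∑ l, MvPolynomial.eval v (A (Sum.inr u) l) * x l =
        MvPolynomial.eval v P * ∑ l, θ l * x l -
          ∑ j, MvPolynomial.eval v (B j) * ∑ l, ψ j l * x l := by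
    intro v u x
    simp only [Finset.mul_sum]
    rw [Finset.sum_comm, ← Finset.sum_sub_distrib]
    refine Finset.sum_congr rfl fun l _ => ?_
    simp only [A, Sum.elim_inr, map_sub, map_mul, map_sum, MvPolynomial.eval_C, sub_mul,
      Finset.sum_mul]
    congr 1
    · ring
    · exact Finset.sum_congr rfl fun j _ => by ring
  refine tangent_pullback_isomorphic f _ (by simp) A ?_ ?_ ?_
  · rintro (r | u) l
    · exact ((MvPolynomial.isHomogeneous_X ℂ 1).C_mul _).sub
        ((MvPolynomial.isHomogeneous_X ℂ 0).C_mul _)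
    · exact (hP.C_mul _).sub (MvPolynomial.IsHomogeneous.sum _ _ _ fun j _ => (hB j).C_mul _)
  · rintro v (r | u)
    · rw [hAl, hψ, hψ, Fin.val_castSucc, Fin.val_succ,
        show m - (r : ℕ) = m - ((r : ℕ) + 1) + 1 by omega]
      ring
    · rw [hAr, hBv, Finset.mul_sum, sub_eq_zero]
      refine Finset.sum_congr rfl fun j _ => ?_
      rw [hψ]
      ring
  · intro v hv x hx
    obtain ⟨c, hc⟩ := exists_eq_mul_monomial hv (fun j => ∑ l, ψ j l * x l) fun r => by
      rw [← sub_eq_zero, ← hAl]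
      exact hx (Sum.inl r)
    have hcθ : MvPolynomial.eval v P * ∑ l, θ l * x l =
        c * ∑ l, θ l * MvPolynomial.eval v (f.F l) := by
      have h := hx (Sum.inr ())
      rw [hAr, sub_eq_zero] at h
      rw [h, hBv, Finset.mul_sum]
      refine Finset.sum_congr rfl fun j _ => ?_
      rw [hc j]
      ring
    have hsub : ∀ (w y : Fin (m + 2) → ℂ) (b : ℂ),
        ∑ l, w l * (x l - b * y l) = ∑ l, w l * x l - b * ∑ l, w l * y l := by
      intro w y b
      rw [Finset.mul_sum, ← Finset.sum_sub_distrib]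
      exact Finset.sum_congr rfl fun l _ => by ring
    suffices ∃ b, (fun l => x l - b * MvPolynomial.eval v (f.F l)) = 0 by
      obtain ⟨b, hb⟩ := this
      exact ⟨b, fun l => sub_eq_zero.1 (congrFun hb l)⟩
    -- In these coordinates `x` satisfies `ψ_j(x) = c s^(m-j) t^j` and `P θ(x) = c θ(f)`, so `b = c
    -- / P` where `P ≠ 0`. At a zero of `P`, `hθ` forces `c = 0`, and `b` is read off from `θ`.
    by_cases hPv : MvPolynomial.eval v P = 0
    · have h0 := hθ v hv hPv
      rw [hPv, zero_mul] at hcθ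
      have hc0 := (mul_eq_zero.1 hcθ.symm).resolve_right h0
      refine ⟨(∑ l, θ l * x l) / ∑ l, θ l * MvPolynomial.eval v (f.F l), hinj _ ?_ fun j => ?_⟩
      · rw [hsub, div_mul_cancel₀ _ h0, sub_self]
      · rw [hsub, hψ, hc, hc0, hPv]
        ring
    · refine ⟨c / MvPolynomial.eval v P, hinj _ ?_ fun j => ?_⟩
      · rw [hsub, div_mul_eq_mul_div, ← hcθ, mul_div_cancel_left₀ _ hPv, sub_self]
      · rw [hsub, hψ, hc]
        field_simp
        ring

end
noncomputable section

/-! ### Linear algebra of the rational normal curve -/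

section RationalNormalCurve

/-- The vector `(s^n, s^(n-1) t, …, t^n)`. -/
def veroneseVec (n : ℕ) (v : Fin 2 → ℂ) : Fin (n + 1) → ℂ :=
  fun i => v 0 ^ (n - (i : ℕ)) * v 1 ^ (i : ℕ)

theorem eval_veronese (n : ℕ) (v : Fin 2 → ℂ) :
    (fun i => MvPolynomial.eval v ((veronese n).F i)) = veroneseVec n v := by
  funext i
  simp [veronese, veroneseVec]

theorem veronese_mk (n : ℕ) {v : Fin 2 → ℂ} (hv : v ≠ 0) :
    ((veronese n).toFun (Projectivization.mk ℂ v hv)).submodule =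
      Submodule.span ℂ {veroneseVec n v} := by
  rw [ProjMorphism.toFun_mk, Projectivization.submodule_mk, eval_veronese]

theorem eval_project {n M : ℕ} (π : (Fin (n + 1) → ℂ) →ₗ[ℂ] (Fin (M + 1) → ℂ))
    (h : ∀ p, ¬ ((veronese n).toFun p).submodule ≤ LinearMap.ker π) (v : Fin 2 → ℂ)
    (l : Fin (M + 1)) :
    MvPolynomial.eval v (((veronese n).project π h).F l) = π (veroneseVec n v) l := by
  rw [LinearMap.pi_apply_eq_sum_univ π, ← eval_veronese]
  have hs : ∀ i : Fin (n + 1), (Pi.single i 1 : Fin (n + 1) → ℂ) = fun j => if i = j then 1 else 0 :=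
    fun i => funext fun j => by simp [Pi.single_apply, eq_comm]
  simp [ProjMorphism.project, mul_comm, hs]

/-- A form of degree `n` is the restriction of a linear functional to the rational normal curve. -/
theorem exists_functional_of_isHomogeneous {n : ℕ} {H : MvPolynomial (Fin 2) ℂ}
    (hH : H.IsHomogeneous n) :
    ∃ c : (Fin (n + 1) → ℂ) →ₗ[ℂ] ℂ, ∀ v, c (veroneseVec n v) = MvPolynomial.eval v H := by
  -- On the support `d 1 ≤ n`, so the reduction modulo `n + 1` in `Fin.ofNat` changes nothing.
  refine ⟨∑ d ∈ H.support, MvPolynomial.coeff d H • LinearMap.proj (Fin.ofNat (n + 1) (d 1)),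
    fun v => ?_⟩
  rw [MvPolynomial.eval_eq', LinearMap.sum_apply]
  refine Finset.sum_congr rfl fun d hd => ?_
  have h := degree_fin_two hH hd
  have h1 : d 1 % (n + 1) = d 1 := Nat.mod_eq_of_lt (by omega)
  simp only [LinearMap.smul_apply, LinearMap.proj_apply, veroneseVec, Fin.val_ofNat, h1,
    Fin.prod_univ_two, smul_eq_mul]
  rw [show n - d 1 = d 0 by omega]

/-- Distinct points of the rational normal curve of degree `n`, at most `n + 1` in number, are
linearly independent. -/
theorem linearIndependent_veroneseVec {ι : Type} [Fintype ι] [DecidableEq ι] {n : ℕ}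
    (hn : Fintype.card ι ≤ n + 1) (a : ι → Fin 2 → ℂ)
    (ha : ∀ i j, MvPolynomial.eval (a j) (linForm (a i)) = 0 → i = j) (ha0 : ∀ i, a i ≠ 0) :
    LinearIndependent ℂ fun i => veroneseVec n (a i) := by
  rw [Fintype.linearIndependent_iff]
  intro g hg i
  obtain ⟨s, hs⟩ := Function.ne_iff.1 (ha0 i)
  -- This form vanishes at every chosen point except `a i`, so it isolates `g i`. The power of a
  -- coordinate nonzero at `a i` pads the degree to `n`.
  have hH : ((∏ l ∈ Finset.univ.erase i, linForm (a l)) *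
      MvPolynomial.X s ^ (n + 1 - Fintype.card ι)).IsHomogeneous n := by
    have h := (isHomogeneous_prod_linForm (Finset.univ.erase i) a).mul
      (MvPolynomial.isHomogeneous_X_pow (R := ℂ) s (n + 1 - Fintype.card ι))
    have hpos : 0 < Fintype.card ι := Fintype.card_pos_iff.2 ⟨i⟩
    rwa [Finset.card_erase_of_mem (Finset.mem_univ i), Finset.card_univ,
      show Fintype.card ι - 1 + (n + 1 - Fintype.card ι) = n by omega] at h
  obtain ⟨c, hc⟩ := exists_functional_of_isHomogeneous hH
  have h := congrArg c hg
  simp only [map_sum, map_smul, map_zero, hc, map_mul, map_prod, smul_eq_mul] at h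
  rw [Finset.sum_eq_single i] at h
  · refine (mul_eq_zero.1 h).resolve_right (mul_ne_zero (Finset.prod_ne_zero_iff.2 ?_) ?_)
    · intro l hl h0
      exact Finset.ne_of_mem_erase hl (ha l i h0)
    · simpa using fun h => absurd h hs
  · intro j _ hj
    rw [Finset.prod_eq_zero (Finset.mem_erase.2 ⟨hj, Finset.mem_univ j⟩), zero_mul, mul_zero]
    rw [eval_linForm]
    ring
  · simp

/-- A functional that vanishes on the kernel of `π` factors through `π`. -/
theorem exists_factor_through {n m : ℕ} (π : (Fin n → ℂ) →ₗ[ℂ] (Fin m → ℂ))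
    (c : (Fin n → ℂ) →ₗ[ℂ] ℂ) (h : LinearMap.ker π ≤ LinearMap.ker c) :
    ∃ a : Fin m → ℂ, ∀ u, ∑ l, a l * π u l = c u := by
  have hc : c ∈ (LinearMap.ker π).dualAnnihilator :=
    (Submodule.mem_dualAnnihilator c).2 fun w hw => h hw
  rw [← LinearMap.range_dualMap_eq_dualAnnihilator_ker] at hc
  obtain ⟨ψ, hψ⟩ := hc
  refine ⟨fun l => ψ (Pi.single l 1), fun u => ?_⟩
  have hs : ∀ i : Fin m, (Pi.single i 1 : Fin m → ℂ) = fun j => if i = j then 1 else 0 :=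
    fun i => funext fun j => by simp [Pi.single_apply, eq_comm]
  rw [← hψ, LinearMap.dualMap_apply, LinearMap.pi_apply_eq_sum_univ ψ]
  simp [mul_comm, hs]

/-- If `L` has codimension one in `M`, some functional has kernel `L` on `M`. -/
theorem exists_functional_hyperplane {V : Type} [AddCommGroup V] [Module ℂ V]
    [FiniteDimensional ℂ V] {L M : Submodule ℂ V} (hLM : L ≤ M)
    (h : Module.finrank ℂ M = Module.finrank ℂ L + 1) :
    ∃ θ : V →ₗ[ℂ] ℂ, L ≤ LinearMap.ker θ ∧ ∀ u ∈ M, θ u = 0 → u ∈ L := by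
  obtain ⟨u₀, hu₀, hu₀L⟩ : ∃ u ∈ M, u ∉ L := by
    by_contra! hle
    rw [le_antisymm hLM hle] at h
    omega
  obtain ⟨θ, hθ, hθL⟩ := Submodule.exists_le_ker_of_notMem hu₀L
  refine ⟨θ, hθL, fun u hu hu0 => ?_⟩
  have hlt : LinearMap.ker θ ⊓ M < M :=
    lt_of_le_of_ne inf_le_right fun heq => hθ (LinearMap.mem_ker.1 (heq.ge hu₀).1)
  have heq : L = LinearMap.ker θ ⊓ M := by
    refine Submodule.eq_of_le_of_finrank_le (le_inf hθL hLM) ?_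
    have := Submodule.finrank_lt_finrank_of_lt hlt
    omega
  rw [heq]
  exact ⟨hu0, hu⟩

/-- Representatives of the points of intersection of a secant space with the curve. -/
theorem IsSecant.exists_points {n m : ℕ} {M : Submodule ℂ (Fin (n + 1) → ℂ)} (h : IsSecant m M) :
    ∃ a : Fin m → Fin 2 → ℂ, (∀ i, a i ≠ 0) ∧ (∀ i, veroneseVec n (a i) ∈ M) ∧
      ∀ i j, MvPolynomial.eval (a j) (linForm (a i)) = 0 → i = j := by
  obtain ⟨S, hS, hSC, hSM⟩ := h
  choose! p hp using fun q (hq : q ∈ S) => (hSC hq : ∃ p, (veronese n).toFun p = q)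
  let e := (S.equivFinOfCardEq hS).symm
  refine ⟨fun i => (p (e i)).rep, fun i => (p (e i)).rep_nonzero, fun i => ?_, fun i j hij => ?_⟩
  · have h := hSM _ (e i).2
    rw [← hp _ (e i).2, ← Projectivization.mk_rep (p (e i)), veronese_mk,
      Submodule.span_singleton_le_iff_mem] at h
    exact h
  · have h := mk_eq_mk_of_eval_linForm (p (e i)).rep_nonzero (p (e j)).rep_nonzero hij
    rw [Projectivization.mk_rep, Projectivization.mk_rep] at h
    apply e.injective
    apply Subtype.ext
    rw [← hp _ (e i).2, ← hp _ (e j).2, h]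

/-- Supplies `P`, `ψ` and `θ` from the secant space; the parameter `m` stands for `n - k - 1` and
avoids truncated subtraction. -/
theorem tangent_project_veronese {n m k : ℕ} (hn : n = m + (k + 1))
    (L : Submodule ℂ (Fin (n + 1) → ℂ)) (hL : Module.finrank ℂ L = k)
    (hLC : ∀ q ∈ rationalNormalCurve n, ¬ q.submodule ≤ L)
    (M : Submodule ℂ (Fin (n + 1) → ℂ)) (hM : Module.finrank ℂ M = k + 1)
    (hMC : IsSecant (k + 1) M) (hLM : L ≤ M)
    (π : (Fin (n + 1) → ℂ) →ₗ[ℂ] (Fin (m + 1 + 1) → ℂ)) (hπ : LinearMap.ker π = L)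
    (h : ∀ p, ¬ ((veronese n).toFun p).submodule ≤ LinearMap.ker π) :
    AlgBundle.Isomorphic ((tangentPSpace (m + 1)).pullback ((veronese n).project π h))
      (sumO 1 (Sum.elim (fun _ : Fin m => (n : ℤ) + 1) (fun _ : Unit => (n : ℤ) + 1 + k))) := by
  obtain ⟨a, ha0, haM, ha⟩ := hMC.exists_points
  have hspan : Submodule.span ℂ (Set.range fun i => veroneseVec n (a i)) = M := by
    have hli := linearIndependent_veroneseVec (n := n) (by simp; omega) a ha ha0
    refine Submodule.eq_of_le_of_finrank_eq (Submodule.span_le.2 ?_) ?_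
    · rintro _ ⟨i, rfl⟩
      exact haM i
    · rw [finrank_span_eq_card hli, hM, Fintype.card_fin]
  set P := ∏ i, linForm (a i) with hPdef
  have hP : P.IsHomogeneous (k + 1) := by
    simpa using isHomogeneous_prod_linForm Finset.univ a
  have hPa : ∀ i, MvPolynomial.eval (a i) P = 0 := by
    intro i
    rw [hPdef, map_prod]
    refine Finset.prod_eq_zero (Finset.mem_univ i) ?_
    rw [eval_linForm]
    ring
  have hψ : ∀ j : Fin (m + 1), ∃ w : Fin (m + 2) → ℂ, ∀ v,
      ∑ l, w l * π (veroneseVec n v) l =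
        MvPolynomial.eval v P * (v 0 ^ (m - (j : ℕ)) * v 1 ^ (j : ℕ)) := by
    intro j
    have hH : (P * (MvPolynomial.X 0 ^ (m - (j : ℕ)) * MvPolynomial.X 1 ^ (j : ℕ))).IsHomogeneous
        n := by
      have h := hP.mul ((MvPolynomial.isHomogeneous_X_pow (R := ℂ) (0 : Fin 2) (m - (j : ℕ))).mul
        (MvPolynomial.isHomogeneous_X_pow (R := ℂ) (1 : Fin 2) (j : ℕ)))
      rwa [show k + 1 + (m - (j : ℕ) + (j : ℕ)) = n by omega] at h
    obtain ⟨c, hc⟩ := exists_functional_of_isHomogeneous hH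
    -- The functional vanishes at the secant points, hence on their span `M`, hence on `L = ker π`,
    -- so it descends along `π`.
    have hcM : M ≤ LinearMap.ker c := by
      rw [← hspan, Submodule.span_le]
      rintro _ ⟨i, rfl⟩
      simp [hc, hPa]
    obtain ⟨w, hw⟩ := exists_factor_through π c (hπ ▸ hLM.trans hcM)
    exact ⟨w, fun v => by simp [hw, hc]⟩
  choose ψ hψ using hψ
  obtain ⟨c, hcL, hcM⟩ := exists_functional_hyperplane hLM (by rw [hM, hL])
  obtain ⟨θ, hθ⟩ := exists_factor_through π c (hπ ▸ hcL)
  have hev : ∀ (v : Fin 2 → ℂ) (w : Fin (m + 2) → ℂ),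
      ∑ l, w l * MvPolynomial.eval v (((veronese n).project π h).F l) =
        ∑ l, w l * π (veroneseVec n v) l :=
    fun v w => Finset.sum_congr rfl fun l _ => congrArg (w l * ·) (eval_project π h v l)
  have key := tangent_pullback_isomorphic_of_forms (m := m) (k := k) ((veronese n).project π h)
    hn hP (Finset.prod_ne_zero_iff.2 fun i _ => linForm_ne_zero (ha0 i)) (ha0 0) (hPa 0) ψ θ
    (fun v j => (hev v (ψ j)).trans (hψ j v)) fun v hv hPv h0 => by
      rw [hev, hθ] at h0
      rw [hPdef, map_prod, Finset.prod_eq_zero_iff] at hPv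
      obtain ⟨i, -, hi⟩ := hPv
      -- A zero of `P` is a secant point, so its image lies in `M`; if `θ` vanished there, the image
      -- would lie in `L`, against `hLC`.
      have heq := mk_eq_mk_of_eval_linForm (ha0 i) hv hi
      have hvM : veroneseVec n v ∈ M := by
        rw [← Submodule.span_singleton_le_iff_mem, ← veronese_mk n hv, heq, veronese_mk,
          Submodule.span_singleton_le_iff_mem]
        exact haM i
      refine hLC _ (Set.mem_range_self (Projectivization.mk ℂ v hv)) ?_
      rw [veronese_mk, Submodule.span_singleton_le_iff_mem]
      exact hcM _ hvM h0
  convert key using 2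
  funext r
  rcases r with r | r
  · simp [ProjMorphism.project, veronese]
  · simp [ProjMorphism.project, veronese]
    ring

end RationalNormalCurve

end

/-! ### The splitting theorem -/

theorem mainTheorem2 (n k : ℕ) (hk : 1 ≤ k) (hkn : 2 * k ≤ n)
    (L : Submodule ℂ (Fin (n + 1) → ℂ)) (hL : Module.finrank ℂ L = k)
    (hLC : ∀ q ∈ rationalNormalCurve n, ¬ q.submodule ≤ L)
    (hsec : ∃ M : Submodule ℂ (Fin (n + 1) → ℂ),
      Module.finrank ℂ M = k + 1 ∧ IsSecant (k + 1) M ∧ L ≤ M)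
    (π : (Fin (n + 1) → ℂ) →ₗ[ℂ] (Fin (n - k + 1) → ℂ)) (hπ : LinearMap.ker π = L) :
    AlgBundle.Isomorphic
      ((tangentPSpace (n - k)).pullback
        ((veronese n).project π fun p hp => hLC _ (Set.mem_range_self p) (hπ ▸ hp)))
      (sumO 1 (Sum.elim (fun _ : Fin (n - k - 1) => (n : ℤ) + 1)
        (fun _ : Unit => (n : ℤ) + 1 + k))) := by
  obtain ⟨M, hM, hMC, hLM⟩ := hsec
  obtain ⟨m, hm⟩ : ∃ m, n - k = m + 1 := ⟨n - k - 1, by omega⟩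
  have hn : n = m + (k + 1) := by omega
  -- The types of `π` and of the bundles depend on `n - k`, so it becomes a variable before being
  -- replaced by `m + 1`.
  generalize n - k = r at *
  subst hm
  exact tangent_project_veronese hn L hL hLC M hM hMC hLM π hπ _
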